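/- **Conventions.** All graphs are finite. A half-edge ribbon graph (HERG) $G_H$ is a (not necessarily orientable) ribbon graph, with vertex discs $V$ and edge ribbons $E$, together with a finite set $H$ of half-ribbons; a half-ribbon is a rectangle glued to a vertex disc along one of its sides, and the opposite side is its external segment. A boundary component of the surface $G_H$ is an *external cycle* if it contains an external segment, and a *closed face* otherwise; $C_{\rm ext}(G_H)$ and $f_{\rm int}(G_H)$ are the numbers of external cycles and of closed faces. The *dual* $G_H^*$ has one vertex disc for each boundary component of $G_H$; each edge ribbon of $G_H$ gives the dual ribbon crossing it, and each half-ribbon of $G_H$ gives a half-ribbon at the vertex dual to the external cycle that contains it, the ribbons and half-ribbons being ordered around a dual vertex as along the boundary component. Cutting an edge means deleting it and attaching a half-ribbon in place of each of its two ends. A *spanning cutting subgraph* $A\Subset G_H$ is obtained by cutting an arbitrary set of edges; in particular $G_H\vee E(G_H)$ is obtained by cutting all edges. Define $$\mathcal R_{G_H}(x,y,z,s,w,t)=\sum_{A\Subset G_H}(x-1)^{r(G_H)-r(A)}\,y^{n(A)}\,z^{k(A)-f_{\rm int}(A)+n(A)}\,s^{C_{\rm ext}(A)}\,w^{o(A)}\,t^{|H(A)|},$$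 $$M_{G_H}(a,b)=\sum_{A\in\{G_H\vee E(G_H),\,G_H\}}a^{f_{\rm int}(A)}\,b^{C_{\rm ext}(A)},$$ where $k(A)$, $r(A)=|V(A)|-k(A)$ and $n(A)=|E(A)|-r(A)$ are the number of connected components, the rank and the nullity of $A$, $|H(A)|$ is its number of half-ribbons, and $o(A)=0$ if $A$ is orientable and $1$ otherwise. **Theorem.** Let $G_H$ be a HERG. The following equalities hold in $\mathbb Z[a,a^{-1},b]/(b^2-ab)$. (1) If $C_{\rm ext}(G_H)>0$, then $$\mathcal R_{G_H}(a+1,a,a^{-1},b,1,1)=\mathcal R_{G_H^*}(a+1,a,a^{-1},b,1,1).$$ (2) If $G_H$ is connected and $C_{\rm ext}(G_H)=0$, then $$a\,\mathcal R_{G_H}(a+1,a,a^{-1},b,1,1)-M_{G_H}(a,b)=a\,\mathcal R_{G_H^*}(a+1,a,a^{-1},b,1,1)-M_{G_H^*}(a,b).$$ -/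

import Mathlib

/-!
# Half-edge ribbon graphs

A half-edge ribbon graph (HERG) is encoded by its flags (Tutte's encoding of ribbon graphs and maps).

An edge ribbon is a rectangle `[0,1] × [0,1]` whose two ends `{i} × [0,1]` are glued to vertex
discs and whose two sides `[0,1] × {j}` are free; its four corners are the flags `edge e i j`.
A half-ribbon is a rectangle glued to a vertex disc along one segment only. Its two corners on the
vertex disc are the flags `half h j`; its free boundary consists of two sides and of the
external segment, and joins these two corners.
-/

inductive RibbonFlag (E H : Type*) where
  /-- The corner of the ribbon `e` at the end `i` and on the side `j`. -/
  | edge (e : E) (i j : Bool) : RibbonFlag E H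
  /-- One of the two corners at which the half-ribbon `h` meets its vertex. -/
  | half (h : H) (j : Bool) : RibbonFlag E H

namespace RibbonFlag

/-- Move along the segment by which a ribbon or half-ribbon is glued to a vertex disc. -/
def arc {E H : Type*} : RibbonFlag E H → RibbonFlag E H
  | edge e i j => edge e i (!j)
  | half h j => half h (!j)

/-- Move along the free boundary of a ribbon (one of its two sides) or of a half-ribbon
(side, external segment, side). -/
def side {E H : Type*} : RibbonFlag E H → RibbonFlag E H
  | edge e i j => edge e (!i) j
  | half h j => half h (!j)

/-- The flags of the dual: the dual ribbon is the same rectangle with the roles of its ends and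
of its sides exchanged. -/
def swap {E H : Type*} : RibbonFlag E H → RibbonFlag E H
  | edge e i j => edge e j i
  | half h j => half h j

theorem swap_swap {E H : Type*} (f : RibbonFlag E H) : f.swap.swap = f := by
  cases f <;> rfl

theorem swap_arc {E H : Type*} (f : RibbonFlag E H) : f.arc.swap = f.swap.side := by
  cases f <;> rfl

/-- The flags of the graph in which the edges outside `A` are cut, as flags of the original graph:
cutting `e` turns its two ends into two half-ribbons `(e, false)` and `(e, true)`. -/
def uncut {E H : Type*} (A : Finset E) :
    RibbonFlag {e // e ∈ A} (H ⊕ {e // e ∉ A} × Bool) → RibbonFlag E H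
  | edge e i j => edge e.1 i j
  | half (Sum.inl h) j => half h j
  | half (Sum.inr (e, i)) j => edge e.1 i j

open Classical in
/-- The inverse of `uncut`. -/
noncomputable def cut {E H : Type*} (A : Finset E) :
    RibbonFlag E H → RibbonFlag {e // e ∈ A} (H ⊕ {e // e ∉ A} × Bool)
  | edge e i j => if h : e ∈ A then edge ⟨e, h⟩ i j else half (Sum.inr (⟨e, h⟩, i)) j
  | half h j => half (Sum.inl h) j

theorem uncut_cut {E H : Type*} (A : Finset E) (f : RibbonFlag E H) : (f.cut A).uncut A = f := by
  cases f with
  | edge e i j => by_cases h : e ∈ A <;> simp [cut, uncut, h]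
  | half h j => rfl

theorem cut_uncut {E H : Type*} (A : Finset E)
    (f : RibbonFlag {e // e ∈ A} (H ⊕ {e // e ∉ A} × Bool)) : (f.uncut A).cut A = f := by
  match f with
  | edge e i j => simp [cut, uncut]
  | half (Sum.inl h) j => rfl
  | half (Sum.inr (e, i)) j => simp [cut, uncut, e.2]

theorem uncut_arc {E H : Type*} (A : Finset E)
    (f : RibbonFlag {e // e ∈ A} (H ⊕ {e // e ∉ A} × Bool)) : f.arc.uncut A = (f.uncut A).arc := by
  match f with
  | edge e i j => rfl
  | half (Sum.inl h) j => rfl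
  | half (Sum.inr (e, i)) j => rfl

theorem eqvGen_map {α β : Type*} {r : α → α → Prop} {r' : β → β → Prop} (φ : α → β)
    (hr : ∀ x y, r x y → r' (φ x) (φ y)) {x y : α} (h : Relation.EqvGen r x y) :
    Relation.EqvGen r' (φ x) (φ y) := by
  induction h with
  | rel x y h => exact .rel _ _ (hr _ _ h)
  | refl x => exact .refl _
  | symm x y _ ih => exact ih.symm
  | trans x y z _ _ ih₁ ih₂ => exact ih₁.trans _ _ _ ih₂

end RibbonFlag

/-- A half-edge ribbon graph with vertex discs `V`, ribbon edges `E` and half-ribbons `H`.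
The ribbons may be twisted and the underlying surface need not be connected or orientable. -/
structure HERG (V E H : Type*) where
  /-- Move along a free arc of the boundary circle of a vertex disc, from a corner of a ribbon or
  half-ribbon to the next corner. -/
  corner : RibbonFlag E H → RibbonFlag E H
  corner_corner : ∀ f, corner (corner f) = f
  corner_ne : ∀ f, corner f ≠ f
  /-- The vertex disc at which a flag lies. A vertex at which there is no flag is a bare disc. -/
  vert : RibbonFlag E H → V
  /-- The flags at a vertex form exactly one circle, the boundary of the vertex disc. -/
  vert_eq_iff : ∀ f g, vert f = vert g ↔
    Relation.EqvGen (fun f g => g = f.arc ∨ g = corner f) f g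

namespace HERG

/-- One step along the boundary of the surface. -/
def BoundaryStep {V E H : Type*} (G : HERG V E H) (f g : RibbonFlag E H) : Prop :=
  g = f.side ∨ g = G.corner f

/-- The boundary components of a HERG, as a surface: the boundary circles of the bare discs, and
the closed curves that run alternately along free arcs of the vertex discs and along the free
boundaries of ribbons and half-ribbons. -/
abbrev BoundaryComponent {V E H : Type*} (G : HERG V E H) :=
  {v : V // ∀ f, G.vert f ≠ v} ⊕ Quot G.BoundaryStep

/-- A boundary component is an external cycle if it contains the external segment of some
half-ribbon; otherwise it is a closed face. -/
def IsExternal {V E H : Type*} (G : HERG V E H) (c : G.BoundaryComponent) : Prop :=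
  ∃ (h : H) (j : Bool), c = Sum.inr (Quot.mk _ (RibbonFlag.half h j))

/-- The number `f_int` of closed faces. -/
noncomputable def closedFaces {V E H : Type*} (G : HERG V E H) : ℕ :=
  Nat.card {c : G.BoundaryComponent // ¬ G.IsExternal c}

/-- The number `C_ext` of external cycles. -/
noncomputable def externalCycles {V E H : Type*} (G : HERG V E H) : ℕ :=
  Nat.card {c : G.BoundaryComponent // G.IsExternal c}

/-- `u` and `v` are the two ends of an edge. -/
def Adj {V E H : Type*} (G : HERG V E H) (u v : V) : Prop :=
  ∃ (e : E) (j j' : Bool), G.vert (RibbonFlag.edge e false j) = u ∧ G.vert (RibbonFlag.edge e true j') = v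

/-- The number `k` of connected components. -/
noncomputable def components {V E H : Type*} (G : HERG V E H) : ℕ := Nat.card (Quot G.Adj)

/-- The rank `r = |V| - k`. -/
noncomputable def rank {V E H : Type*} (G : HERG V E H) : ℕ := Nat.card V - G.components

/-- The nullity `n = |E| - r`. -/
noncomputable def nullity {V E H : Type*} (G : HERG V E H) : ℕ := Nat.card E - G.rank

/-- The surface is orientable: the flags can be coloured by two colours that alternate along
every move. -/
def Orientable {V E H : Type*} (G : HERG V E H) : Prop :=
  ∃ σ : RibbonFlag E H → Bool, ∀ f, σ f.arc = !σ f ∧ σ f.side = !σ f ∧ σ (G.corner f) = !σ f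

open Classical in
/-- `0` if the surface is orientable and `1` otherwise. -/
noncomputable def orientIndex {V E H : Type*} (G : HERG V E H) : ℕ :=
  if G.Orientable then 0 else 1

/-- The spanning cutting subgraph with edge set `A`: every edge outside `A` is cut, that is,
deleted and replaced by two half-ribbons, attached where its two ends were. -/
noncomputable def cut {V E H : Type*} (G : HERG V E H) (A : Finset E) :
    HERG V {e // e ∈ A} (H ⊕ {e // e ∉ A} × Bool) where
  corner f := (G.corner (f.uncut A)).cut A
  corner_corner f := by rw [RibbonFlag.uncut_cut, G.corner_corner, RibbonFlag.cut_uncut]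
  corner_ne f h := G.corner_ne (f.uncut A) (by rw [← RibbonFlag.uncut_cut A (G.corner _), h])
  vert f := G.vert (f.uncut A)
  vert_eq_iff f g := by
    rw [G.vert_eq_iff]
    constructor
    · intro h
      rw [← RibbonFlag.cut_uncut A f, ← RibbonFlag.cut_uncut A g]
      refine RibbonFlag.eqvGen_map (RibbonFlag.cut A) ?_ h
      rintro x y (rfl | rfl)
      · left
        rw [← RibbonFlag.cut_uncut A ((RibbonFlag.cut A x).arc), RibbonFlag.uncut_arc,
          RibbonFlag.uncut_cut]
      · right
        rw [RibbonFlag.uncut_cut]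
    · refine RibbonFlag.eqvGen_map (RibbonFlag.uncut A) ?_
      rintro x y (rfl | rfl)
      · exact Or.inl (RibbonFlag.uncut_arc A x)
      · exact Or.inr (RibbonFlag.uncut_cut A _)

/-- The geometric dual. Its vertex discs are glued along the boundary components of `G` (closed
faces and external cycles), the vertex discs of `G` are removed, and every dual ribbon crosses its
ribbon, i.e. it is the same rectangle attached along the other pair of opposite segments.
Every half-ribbon on an external cycle gives one half-ribbon of the dual vertex, with the same
cyclic order of ribbons and half-ribbons around the dual vertex as along the external cycle
(there is one puncture for each half-ribbon, at which both it and its dual end). A bare disc is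
its own dual. -/
def dual {V E H : Type*} (G : HERG V E H) : HERG G.BoundaryComponent E H where
  corner f := (G.corner f.swap).swap
  corner_corner f := by rw [RibbonFlag.swap_swap, G.corner_corner, RibbonFlag.swap_swap]
  corner_ne f h := G.corner_ne f.swap (by rw [← RibbonFlag.swap_swap (G.corner _), h])
  vert f := Sum.inr (Quot.mk _ f.swap)
  vert_eq_iff f g := by
    rw [Sum.inr.injEq, Quot.eq]
    constructor
    · intro h
      rw [← RibbonFlag.swap_swap f, ← RibbonFlag.swap_swap g]
      refine RibbonFlag.eqvGen_map RibbonFlag.swap ?_ h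
      rintro x y (rfl | rfl)
      · left
        rw [← RibbonFlag.swap_swap (x.swap.arc), RibbonFlag.swap_arc, RibbonFlag.swap_swap]
      · right
        rw [RibbonFlag.swap_swap]
    · refine RibbonFlag.eqvGen_map RibbonFlag.swap ?_
      rintro x y (rfl | rfl)
      · exact Or.inl (RibbonFlag.swap_arc x)
      · exact Or.inr (RibbonFlag.swap_swap _)

/-- The value at `(x, y, z, s, w, t)` of the polynomial
`∑_A (x-1)^(r(G)-r(A)) y^n(A) z^(k(A)-f_int(A)+n(A)) s^C_ext(A) w^o(A) t^|H(A)|`, summed over the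
spanning cutting subgraphs `A` of `G`, for ring elements `x, y, s, w, t` and a unit `z`. -/
noncomputable def polyR {V E H : Type*} [Fintype E] (G : HERG V E H) {S : Type*} [CommRing S]
    (x y : S) (z : Sˣ) (s w t : S) : S :=
  ∑ A : Finset E,
    (x - 1) ^ (G.rank - (G.cut A).rank) * y ^ (G.cut A).nullity *
      ((z ^ (((G.cut A).components : ℤ) - (G.cut A).closedFaces + (G.cut A).nullity) : Sˣ) : S) *
      s ^ (G.cut A).externalCycles * w ^ (G.cut A).orientIndex *
      t ^ Nat.card (H ⊕ {e // e ∉ A} × Bool)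

open Classical in
/-- The terms `a^f_int(A) b^C_ext(A)` of the two extreme spanning cutting subgraphs: the one with
all edges cut and the one with no edge cut (which are one subgraph if there are no edges). -/
noncomputable def polyM {V E H : Type*} [Fintype E] (G : HERG V E H) {S : Type*} [CommRing S]
    (a b : S) : S :=
  ∑ A ∈ ({∅, Finset.univ} : Finset (Finset E)),
    a ^ (G.cut A).closedFaces * b ^ (G.cut A).externalCycles

end HERG

/-- The ring `ℤ[a, a⁻¹, b] / (b² - a b)`. -/
abbrev QuotRing : Type :=
  Polynomial (LaurentPolynomial ℤ) ⧸
    Ideal.span {(Polynomial.X ^ 2 - Polynomial.C (LaurentPolynomial.T 1) * Polynomial.X :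
      Polynomial (LaurentPolynomial ℤ))}

namespace QuotRing

/-- The class of `a`, an invertible element. -/
noncomputable def a : QuotRingˣ where
  val := Ideal.Quotient.mk _ (Polynomial.C (LaurentPolynomial.T 1))
  inv := Ideal.Quotient.mk _ (Polynomial.C (LaurentPolynomial.T (-1)))
  val_inv := by
    rw [← map_mul, ← map_mul, ← LaurentPolynomial.T_add]; simp
  inv_val := by
    rw [← map_mul, ← map_mul, ← LaurentPolynomial.T_add]; simp

/-- The class of `b`. -/
noncomputable def b : QuotRing := Ideal.Quotient.mk _ Polynomial.X

end QuotRing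

/-!
The proof rests on one observation: the exponents of `a` in the summands of
`𝓡(a + 1, a, a⁻¹, b, 1, 1)` telescope, so that
`𝓡 = a ^ (-k(G)) * ∑ A, a ^ f_int(A) * b ^ C_ext(A)` (`HERG.polyR_eq`), and the number `k(G)` of
components is invariant under duality (`HERG.components_dual`).

Cutting the edges outside `A` in `G` and cutting the edges of `A` in the dual of `G` yield surfaces
with the same boundary curves: a curve that meets the rectangle `e` follows one of its free sides
if `e ∈ A` and runs along one of its ends otherwise, and duality interchanges both sides with ends
and the two sets of edges. Hence `f_int + C_ext` takes the same value on `A` in `G` and on `Aᶜ` in the dual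
(`HERG.card_boundaryComponent_dual_cut`). In a ring with `b² = a b` a monomial `a ^ f * b ^ C` with
`C > 0` depends on `f + C` only, so the two summands agree as soon as both surfaces have a
half-ribbon (`HERG.term_eq_term_dual`).

If `G` has a half-ribbon, this applies to all `A`. If it has none, it applies to all `A` other than
`∅` and the full edge set, and the terms of these two sets are removed by `M`.
-/

namespace RibbonFlag

/-- The flags as a sum of products, from which finiteness follows. -/
def equivSum (E H : Type*) : RibbonFlag E H ≃ (E × Bool × Bool) ⊕ (H × Bool) where
  toFun
    | edge e i j => Sum.inl (e, i, j)
    | half h j => Sum.inr (h, j)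
  invFun
    | Sum.inl (e, i, j) => edge e i j
    | Sum.inr (h, j) => half h j
  left_inv f := by cases f <;> rfl
  right_inv x := by rcases x with ⟨e, i, j⟩ | ⟨h, j⟩ <;> rfl

instance {E H : Type*} [Finite E] [Finite H] : Finite (RibbonFlag E H) :=
  Finite.of_equiv _ (equivSum E H).symm

/-- The identification of the flags of `G` cut outside `A` with those of the dual of `G` cut
outside `B`, through the flags of `G` and of its dual. -/
noncomputable def cutSwap {E H : Type*} (A B : Finset E) :
    RibbonFlag {e // e ∈ A} (H ⊕ {e // e ∉ A} × Bool) ≃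
      RibbonFlag {e // e ∈ B} (H ⊕ {e // e ∉ B} × Bool) where
  toFun f := (f.uncut A).swap.cut B
  invFun f := (f.uncut B).swap.cut A
  left_inv f := by simp only [uncut_cut, swap_swap, cut_uncut]
  right_inv f := by simp only [uncut_cut, swap_swap, cut_uncut]

/-- The free sides of the cut graph and of the complementarily cut dual correspond. -/
theorem cutSwap_side {E H : Type*} {A B : Finset E} (hAB : ∀ e, e ∈ B ↔ e ∉ A)
    (f : RibbonFlag {e // e ∈ A} (H ⊕ {e // e ∉ A} × Bool)) :
    cutSwap A B f.side = (cutSwap A B f).side := by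
  match f with
  | edge e i j => simp [cutSwap, side, uncut, swap, cut, hAB]
  | half (Sum.inl h) j => rfl
  | half (Sum.inr (e, i)) j => simp [cutSwap, side, uncut, swap, cut, hAB, e.2]

end RibbonFlag

namespace HERG

open RibbonFlag

variable {V E H : Type*}

/-! ### Boundary components -/

theorem closedFaces_add_externalCycles [Finite V] [Finite E] [Finite H] (G : HERG V E H) :
    G.closedFaces + G.externalCycles = Nat.card G.BoundaryComponent := by
  classical
  rw [closedFaces, externalCycles, add_comm, ← Nat.card_sum]
  exact Nat.card_congr (Equiv.sumCompl _)

theorem externalCycles_pos_iff [Finite V] [Finite E] [Finite H] (G : HERG V E H) :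
    0 < G.externalCycles ↔ Nonempty H := by
  rw [externalCycles, Nat.card_pos_iff]
  constructor
  · rintro ⟨⟨_, h, _⟩, _⟩
    exact ⟨h⟩
  · rintro ⟨h⟩
    exact ⟨⟨_, h, false, rfl⟩, inferInstance⟩

/-- The bare discs of the dual are those of the original graph. -/
def bareDualEquiv (G : HERG V E H) :
    {v // ∀ f, G.vert f ≠ v} ≃ {c : G.BoundaryComponent // ∀ f, G.dual.vert f ≠ c} where
  toFun v := ⟨Sum.inl v, fun _ h => Sum.inr_ne_inl h⟩
  invFun
    | ⟨Sum.inl v, _⟩ => v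
    | ⟨Sum.inr q, h⟩ => False.elim (by
        induction q using Quot.ind with
        | mk f => exact h f.swap (by simp only [dual, swap_swap]))
  left_inv _ := rfl
  right_inv
    | ⟨Sum.inl _, _⟩ => rfl
    | ⟨Sum.inr q, h⟩ => False.elim (by
        induction q using Quot.ind with
        | mk f => exact h f.swap (by simp only [dual, swap_swap]))

theorem bare_cut_iff (G : HERG V E H) (A : Finset E) (v : V) :
    (∀ f, (G.cut A).vert f ≠ v) ↔ ∀ f, G.vert f ≠ v := by
  refine ⟨fun h f => ?_, fun h f => h _⟩
  simpa only [cut, uncut_cut] using h (f.cut A)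

/-- The boundary circles of `G` with the edges outside `A` cut are those of the dual with the
edges of `A` cut. -/
noncomputable def boundaryQuotEquiv (G : HERG V E H) {A B : Finset E}
    (hAB : ∀ e, e ∈ B ↔ e ∉ A) :
    Quot (G.cut A).BoundaryStep ≃ Quot (G.dual.cut B).BoundaryStep :=
  Quot.congr (cutSwap A B) fun f g => by
    have hc : cutSwap A B ((G.cut A).corner f) = (G.dual.cut B).corner (cutSwap A B f) := by
      simp only [cutSwap, cut, dual, Equiv.coe_fn_mk, uncut_cut, swap_swap]
    rw [BoundaryStep, BoundaryStep, ← cutSwap_side hAB, ← hc, EmbeddingLike.apply_eq_iff_eq,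
      EmbeddingLike.apply_eq_iff_eq]

theorem card_boundaryComponent_dual_cut (G : HERG V E H) {A B : Finset E}
    (hAB : ∀ e, e ∈ B ↔ e ∉ A) :
    Nat.card (G.dual.cut B).BoundaryComponent = Nat.card (G.cut A).BoundaryComponent :=
  Nat.card_congr <| Equiv.symm <| Equiv.sumCongr
    ((Equiv.subtypeEquivRight (G.bare_cut_iff A)).trans <| G.bareDualEquiv.trans
      (Equiv.subtypeEquivRight (G.dual.bare_cut_iff B)).symm)
    (G.boundaryQuotEquiv hAB)

/-! ### Connected components -/

theorem components_le_card [Finite V] (G : HERG V E H) : G.components ≤ Nat.card V :=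
  Nat.card_le_card_of_surjective _ Quot.mk_surjective

theorem components_le_components_cut [Finite V] (G : HERG V E H) (A : Finset E) :
    G.components ≤ (G.cut A).components := by
  refine Nat.card_le_card_of_surjective
    (Quot.map id fun u v ⟨e, j, j', hu, hv⟩ => ⟨e.1, j, j', hu, hv⟩) ?_
  rintro ⟨v⟩
  exact ⟨Quot.mk _ v, rfl⟩

theorem mk_vert_eq (G : HERG V E H) (e : E) (i j i' j' : Bool) :
    Quot.mk G.Adj (G.vert (edge e i j)) = Quot.mk G.Adj (G.vert (edge e i' j')) := by
  have key (k k' : Bool) : Quot.mk G.Adj (G.vert (edge e false k)) =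
      Quot.mk G.Adj (G.vert (edge e true k')) := Quot.sound ⟨e, k, k', rfl, rfl⟩
  cases i <;> cases i'
  · exact (key j j').trans (key j' j').symm
  · exact key _ _
  · exact (key _ _).symm
  · exact (key j j).symm.trans (key j j')

theorem mk_vert_side (G : HERG V E H) (f : RibbonFlag E H) :
    Quot.mk G.Adj (G.vert f.side) = Quot.mk G.Adj (G.vert f) := by
  cases f with
  | edge e i j => exact G.mk_vert_eq e _ _ _ _
  | half h j => exact congrArg _ ((G.vert_eq_iff _ _).2 (.symm _ _ (.rel _ _ (Or.inl rfl))))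

theorem vert_corner (G : HERG V E H) (f : RibbonFlag E H) : G.vert (G.corner f) = G.vert f :=
  (G.vert_eq_iff _ _).2 (.symm _ _ (.rel _ _ (Or.inr rfl)))

/-- Two flags at one vertex lie on boundary components that are connected in the dual. -/
theorem mk_dual_eq_of_vert_eq (G : HERG V E H) {f g : RibbonFlag E H} (h : G.vert f = G.vert g) :
    Quot.mk G.dual.Adj (Sum.inr (Quot.mk _ f)) = Quot.mk G.dual.Adj (Sum.inr (Quot.mk _ g)) := by
  induction (G.vert_eq_iff f g).1 h with
  | rel x y hxy =>
    rcases hxy with rfl | rfl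
    · simpa only [dual, ← swap_arc, swap_swap] using (G.dual.mk_vert_side x.swap).symm
    · exact congrArg (fun q => Quot.mk G.dual.Adj (Sum.inr q)) (Quot.sound (Or.inr rfl))
  | refl x => rfl
  | symm x y hxy ih => exact (ih ((G.vert_eq_iff _ _).2 hxy)).symm
  | trans x y z hxy hyz ih₁ ih₂ =>
    exact (ih₁ ((G.vert_eq_iff _ _).2 hxy)).trans (ih₂ ((G.vert_eq_iff _ _).2 hyz))

/-- The connected component of `G` that a boundary component belongs to. -/
def boundaryToComponent (G : HERG V E H) : G.BoundaryComponent → Quot G.Adj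
  | Sum.inl v => Quot.mk _ v.1
  | Sum.inr q => Quot.lift (fun f => Quot.mk G.Adj (G.vert f)) (by
      rintro f g (rfl | rfl)
      · exact (G.mk_vert_side f).symm
      · rw [G.vert_corner]) q

open Classical in
/-- The component of the dual that contains all boundary components passing a given vertex,
read off from an arbitrary flag at the vertex; a bare disc is its own boundary component. -/
noncomputable def vertexToDualComponent (G : HERG V E H) (v : V) : Quot G.dual.Adj :=
  if h : ∃ f, G.vert f = v then Quot.mk _ (Sum.inr (Quot.mk _ h.choose))
  else Quot.mk _ (Sum.inl ⟨v, not_exists.1 h⟩)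

theorem vertexToDualComponent_vert (G : HERG V E H) (f : RibbonFlag E H) :
    G.vertexToDualComponent (G.vert f) = Quot.mk _ (Sum.inr (Quot.mk _ f)) := by
  have h : ∃ g, G.vert g = G.vert f := ⟨f, rfl⟩
  rw [vertexToDualComponent, dif_pos h]
  exact G.mk_dual_eq_of_vert_eq h.choose_spec

/-- A ribbon graph and its dual have the same connected components. -/
noncomputable def componentEquivDual (G : HERG V E H) : Quot G.Adj ≃ Quot G.dual.Adj where
  toFun := Quot.lift G.vertexToDualComponent (by
    rintro _ _ ⟨e, j, j', rfl, rfl⟩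
    rw [vertexToDualComponent_vert, vertexToDualComponent_vert]
    exact G.dual.mk_vert_eq e j false j' true)
  invFun := Quot.lift G.boundaryToComponent (by
    rintro _ _ ⟨e, j, j', rfl, rfl⟩
    exact G.mk_vert_eq e j false j' true)
  left_inv := by
    rintro ⟨v⟩
    by_cases h : ∃ f, G.vert f = v
    · obtain ⟨f, rfl⟩ := h
      change Quot.lift _ _ (G.vertexToDualComponent _) = _
      rw [vertexToDualComponent_vert]
      rfl
    · change Quot.lift _ _ (G.vertexToDualComponent _) = _
      rw [vertexToDualComponent, dif_neg h]
      rfl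
  right_inv := by
    rintro ⟨v | q⟩
    · exact dif_neg (not_exists.2 v.2)
    · induction q using Quot.ind with
      | mk f => exact G.vertexToDualComponent_vert f

theorem components_dual (G : HERG V E H) : G.dual.components = G.components :=
  Nat.card_congr G.componentEquivDual.symm

/-! ### The polynomials -/

variable {S : Type*} [CommRing S]

/-- The exponent `r(G) - r(A) + n(A) - (k(A) - f_int(A) + n(A))` of `a` is `f_int(A) - k(G)`. -/
theorem polyR_eq [Finite V] [Fintype E] (G : HERG V E H) (a : Sˣ) (b : S) :
    G.polyR ((a : S) + 1) a a⁻¹ b 1 1 = ((a⁻¹ ^ G.components : Sˣ) : S) *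
      ∑ A : Finset E, (a : S) ^ (G.cut A).closedFaces * b ^ (G.cut A).externalCycles := by
  rw [polyR, Finset.mul_sum]
  refine Finset.sum_congr rfl fun A _ => ?_
  have hunit : a ^ (G.rank - (G.cut A).rank) * a ^ (G.cut A).nullity *
      a⁻¹ ^ (((G.cut A).components : ℤ) - (G.cut A).closedFaces + (G.cut A).nullity) =
      a⁻¹ ^ G.components * a ^ (G.cut A).closedFaces := by
    have h₁ := G.components_le_components_cut A
    have h₂ := (G.cut A).components_le_card
    -- `k(G) ≤ k(A) ≤ |V|`, so the subtractions in the ranks and in their difference are honest.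
    have hr : G.rank - (G.cut A).rank = (G.cut A).components - G.components := by
      simp only [rank]
      omega
    rw [hr]
    simp only [← zpow_natCast, inv_zpow', ← zpow_add, Nat.cast_sub h₁]
    congr 1
    ring
  have hS := congrArg (Units.val) hunit
  push_cast at hS ⊢
  simp only [add_sub_cancel_right, one_pow, mul_one]
  rw [hS]
  ring

/-- If `b² = a b`, then `a ^ f * b ^ C` depends only on `f + C`, provided that `C > 0`. -/
theorem pow_mul_pow_eq {a b : S} (hab : b ^ 2 = a * b) (f C : ℕ) :
    a ^ f * b ^ (C + 1) = a ^ (f + C) * b := by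
  induction C generalizing f with
  | zero => simp
  | succ C ih =>
    calc a ^ f * b ^ (C + 1 + 1) = a ^ f * b ^ C * b ^ 2 := by ring
      _ = a ^ (f + 1) * b ^ (C + 1) := by rw [hab]; ring
      _ = a ^ (f + (C + 1)) * b := by rw [ih]; ring

theorem term_eq_term_dual [Finite V] [Finite E] [Finite H] (G : HERG V E H) {a b : S}
    (hab : b ^ 2 = a * b) {A B : Finset E} (hAB : ∀ e, e ∈ B ↔ e ∉ A)
    (hA : Nonempty H ∨ ∃ e, e ∉ A) (hB : Nonempty H ∨ ∃ e, e ∉ B) :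
    a ^ (G.cut A).closedFaces * b ^ (G.cut A).externalCycles =
      a ^ (G.dual.cut B).closedFaces * b ^ (G.dual.cut B).externalCycles := by
  have half_of {D : Finset E} (h : Nonempty H ∨ ∃ e, e ∉ D) :
      Nonempty (H ⊕ {e // e ∉ D} × Bool) := by
    rcases h with ⟨⟨h⟩⟩ | ⟨e, he⟩
    · exact ⟨Sum.inl h⟩
    · exact ⟨Sum.inr (⟨e, he⟩, false)⟩
  obtain ⟨C, hC⟩ := Nat.exists_eq_add_one.2 ((G.cut A).externalCycles_pos_iff.2 (half_of hA))
  obtain ⟨D, hD⟩ := Nat.exists_eq_add_one.2 ((G.dual.cut B).externalCycles_pos_iff.2 (half_of hB))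
  have h := G.card_boundaryComponent_dual_cut hAB
  rw [← closedFaces_add_externalCycles, ← closedFaces_add_externalCycles, hC, hD] at h
  rw [hC, hD, pow_mul_pow_eq hab, pow_mul_pow_eq hab]
  congr 2
  omega

end HERG

theorem QuotRing.b_sq : QuotRing.b ^ 2 = (QuotRing.a : QuotRing) * QuotRing.b := by
  refine Ideal.Quotient.eq.2 ?_
  exact Ideal.mem_span_singleton_self _

theorem theorem5p7 {V E H : Type*} [Finite V] [Fintype E] [Finite H] (G : HERG V E H) :
    (0 < G.externalCycles →
      G.polyR ((QuotRing.a : QuotRing) + 1) (QuotRing.a : QuotRing) QuotRing.a⁻¹ QuotRing.b 1 1 =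
        G.dual.polyR ((QuotRing.a : QuotRing) + 1) (QuotRing.a : QuotRing) QuotRing.a⁻¹
          QuotRing.b 1 1) ∧
    (G.components = 1 → G.externalCycles = 0 →
      (QuotRing.a : QuotRing) * G.polyR ((QuotRing.a : QuotRing) + 1) (QuotRing.a : QuotRing)
          QuotRing.a⁻¹ QuotRing.b 1 1 - G.polyM (QuotRing.a : QuotRing) QuotRing.b =
        (QuotRing.a : QuotRing) * G.dual.polyR ((QuotRing.a : QuotRing) + 1)
          (QuotRing.a : QuotRing) QuotRing.a⁻¹ QuotRing.b 1 1 -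
          G.dual.polyM (QuotRing.a : QuotRing) QuotRing.b) := by
  classical
  rw [HERG.polyR_eq, HERG.polyR_eq, HERG.components_dual]
  constructor
  · intro hpos
    have hH := G.externalCycles_pos_iff.1 hpos
    congr 1
    refine Fintype.sum_equiv (compl_involutive.toPerm _) _ _ fun A => ?_
    exact G.term_eq_term_dual QuotRing.b_sq (fun e => Finset.mem_compl) (Or.inl hH) (Or.inl hH)
  · intro hk _
    rw [hk, pow_one, Units.mul_inv_cancel_left, Units.mul_inv_cancel_left, HERG.polyM, HERG.polyM]
    -- What is left on either side is the sum over the sets other than `∅` and the full edge set.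
    have sum_sub (M : Finset (Finset E)) (F : Finset E → QuotRing) :
        ∑ A, F A - ∑ A ∈ M, F A = ∑ A ∈ Mᶜ, F A :=
      sub_eq_of_eq_add (Finset.sum_compl_add_sum M F).symm
    rw [sum_sub, sum_sub]
    refine Finset.sum_nbij' compl compl ?_ ?_ (fun A _ => compl_compl A)
      (fun A _ => compl_compl A) ?_
    · intro A hA
      simpa [not_or, and_comm] using hA
    · intro A hA
      simpa [not_or, and_comm] using hA
    · intro A hA
      simp only [Finset.mem_compl, Finset.mem_insert, Finset.mem_singleton, not_or] at hA
      refine G.term_eq_term_dual QuotRing.b_sq (fun e => Finset.mem_compl) (Or.inr ?_) (Or.inr ?_)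
      · simpa [Finset.eq_univ_iff_forall] using hA.2
      · simpa [Finset.eq_empty_iff_forall_notMem] using hA.1
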